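/- Define $a_i\in\mathbb{Z}[c]$ by $a_1=c$ and $a_{i+1}=a_i^2+c$ for $i\ge 1$. For integers $m\ge 2$ and $n\ge 1$, let $G_{m,n}$ be the $(m,n)$-Misiurewicz polynomial for the quadratic family $z\mapsto z^2+c$, \[ G_{m,n}(c):=\prod_{k\mid n}\bigl(a_{m+k-1}+a_{m-1}\bigr)^{\mu(n/k)}\cdot \begin{cases}\prod_{k\mid n} a_k^{-\mu(n/k)} & \text{if } n\mid m-1,\\ 1 & \text{if } n\nmid m-1,\end{cases} \] which is a monic polynomial with integer coefficients; here $\mu$ is the Möbius function. Let $m\ge 2$ and $1\le \ell\le n\le 3$ be integers, let $c_0\in\mathbb{C}$ be a root of $G_{m,n}$, and set $K:=\mathbb{Q}(c_0)$. Then $G_{m,\ell}(c_0)$ lies in the ring of integers $\mathcal{O}_K$, and \[ G_{m,\ell}(c_0)\text{ is a unit in }\mathcal{O}_K \quad\Longleftrightarrow\quad \ell\nmid n. \] -/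

import Mathlib

open Polynomial

/-- The critical orbit `a_i ∈ ℤ[c]` of `z ↦ z ^ 2 + c`, indexed so that `a_0 = 0`, `a_1 = c`
and `a_{i+1} = a_i ^ 2 + c`; the variable `X` plays the role of `c`. -/
noncomputable def critOrbit : ℕ → ℤ[X]
  | 0 => 0
  | i + 1 => critOrbit i ^ 2 + X

/-- An integer polynomial, viewed as a rational function over `ℚ`. -/
noncomputable def toRat (P : ℤ[X]) : RatFunc ℚ :=
  algebraMap ℚ[X] (RatFunc ℚ) (P.map (Int.castRingHom ℚ))

/-- The defining product of the quadratic `(m,n)`-Misiurewicz polynomial, formed in the field of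
rational functions in `c` since the Möbius exponents may be negative. -/
noncomputable def misiurewiczProd (m n : ℕ) : RatFunc ℚ :=
  (∏ k ∈ n.divisors,
      toRat (critOrbit (m + k - 1) + critOrbit (m - 1)) ^ ArithmeticFunction.moebius (n / k)) *
    if n ∣ m - 1 then
      ∏ k ∈ n.divisors, toRat (critOrbit k) ^ (-ArithmeticFunction.moebius (n / k))
    else 1

/-- The quadratic `(m,n)`-Misiurewicz polynomial `G_{m,n}`: the defining product, which is a
polynomial, read as an element of `ℚ[c]` (the numerator of `P / 1` is `P`). -/
noncomputable def misiurewicz (m n : ℕ) : ℚ[X] :=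
  (misiurewiczProd m n).num

theorem critOrbit_succ (i : ℕ) : critOrbit (i + 1) = critOrbit i ^ 2 + X := rfl

theorem toRat_mul (P Q : ℤ[X]) : toRat (P * Q) = toRat P * toRat Q := by
  simp [toRat]

theorem toRat_ne_zero {P : ℤ[X]} (h : P ≠ 0) : toRat P ≠ 0 := by
  unfold toRat
  rw [Ne, FaithfulSMul.algebraMap_eq_zero_iff,
    Polynomial.map_eq_zero_iff (RingHom.injective_int _)]
  exact h

theorem critOrbit_spec (i : ℕ) :
    (critOrbit (i + 1)).Monic ∧ (critOrbit (i + 1)).natDegree = 2 ^ i := by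
  induction i with
  | zero => simp [critOrbit, monic_X]
  | succ i ih =>
    obtain ⟨h1, h2⟩ := ih
    have hd : (critOrbit (i + 1) ^ 2).natDegree = 2 ^ (i + 1) := by
      rw [h1.natDegree_pow, h2, pow_succ, mul_comm]
    have hm := h1.pow 2
    have hlt : (X : ℤ[X]).degree < (critOrbit (i + 1) ^ 2).degree := by
      apply degree_lt_degree
      rw [hd, natDegree_X, pow_succ]
      have := Nat.one_le_two_pow (n := i)
      omega
    rw [critOrbit_succ (i + 1)]
    exact ⟨hm.add_of_left hlt, by rw [natDegree_add_eq_left_of_degree_lt hlt, hd]⟩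

theorem critOrbit_add_monic (r k : ℕ) (hr : 1 ≤ r) (hk : 1 ≤ k) :
    (critOrbit (r + k) + critOrbit r).Monic := by
  obtain ⟨s, rfl⟩ : ∃ s, r = s + 1 := ⟨r - 1, by omega⟩
  obtain ⟨j, rfl⟩ : ∃ j, k = j + 1 := ⟨k - 1, by omega⟩
  have h1 := critOrbit_spec (s + 1 + j)
  have h2 := critOrbit_spec s
  refine h1.1.add_of_left (degree_lt_degree ?_)
  rw [h1.2, h2.2]
  exact Nat.pow_lt_pow_right (by norm_num) (by omega)

theorem X_dvd_critOrbit (i : ℕ) : (X : ℤ[X]) ∣ critOrbit i := by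
  induction i with
  | zero => exact dvd_zero _
  | succ i ih => exact dvd_add (dvd_pow ih (by norm_num)) dvd_rfl

/-- If `a_p` vanishes modulo `g`, the critical orbit modulo `g` has period `p`. -/
theorem critOrbit_dvd_sub (p i j : ℕ) :
    critOrbit p ∣ critOrbit (p * j + i) - critOrbit i := by
  induction i with
  | zero =>
    induction j with
    | zero => simp
    | succ j ih =>
      have key : ∀ t, critOrbit (p * j) ∣ critOrbit (p * j + t) - critOrbit t := by
        intro t
        induction t with
        | zero => simp [critOrbit]
        | succ t iht =>
          rw [← add_assoc, critOrbit_succ, critOrbit_succ]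
          have : critOrbit (p * j + t) ^ 2 + X - (critOrbit t ^ 2 + X) =
            (critOrbit (p * j + t) - critOrbit t) * (critOrbit (p * j + t) + critOrbit t) := by
            ring
          rw [this]
          exact Dvd.dvd.mul_right iht _
      have h0 : critOrbit p ∣ critOrbit (p * j) := by simpa [critOrbit] using ih
      have h1 := h0.trans (key p)
      have h2 := dvd_add h1 (dvd_refl (critOrbit p))
      simpa [critOrbit, Nat.mul_succ] using h2
  | succ t iht =>
    rw [← add_assoc, critOrbit_succ, critOrbit_succ]
    have : critOrbit (p * j + t) ^ 2 + X - (critOrbit t ^ 2 + X) =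
      (critOrbit (p * j + t) - critOrbit t) * (critOrbit (p * j + t) + critOrbit t) := by
      ring
    rw [this]
    exact Dvd.dvd.mul_right iht _

/-- For `m ≥ 2` and `1 ≤ n ≤ 3` the defining product is a monic polynomial with integer
coefficients, and `misiurewicz m n` is that polynomial. -/
theorem misiurewicz_eq_map (m n : ℕ) (hm : 2 ≤ m) (hn : 1 ≤ n) (hn3 : n ≤ 3) :
    ∃ P : ℤ[X], P.Monic ∧ misiurewiczProd m n = toRat P ∧
      misiurewicz m n = P.map (Int.castRingHom ℚ) := by
  suffices h : ∃ P : ℤ[X], P.Monic ∧ misiurewiczProd m n = toRat P by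
    obtain ⟨P, h1, h2⟩ := h
    exact ⟨P, h1, h2, by rw [misiurewicz, h2, toRat, RatFunc.num_algebraMap]⟩
  obtain ⟨r, rfl⟩ : ∃ r, m = r + 1 := ⟨m - 1, by omega⟩
  have hr : 1 ≤ r := by omega
  have e : ∀ k, r + 1 + k - 1 = r + k := fun k => by omega
  have m1 := critOrbit_add_monic r 1 hr le_rfl
  have m2 := critOrbit_add_monic r 2 hr (by norm_num)
  have m3 := critOrbit_add_monic r 3 hr (by norm_num)
  have z1 := toRat_ne_zero m1.ne_zero
  have c1 : critOrbit 1 = X := by simp [critOrbit]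
  have c2 : critOrbit 2 = X * (X + 1) := by simp [critOrbit]; ring
  have c3 : critOrbit 3 = X * (X ^ 3 + 2 * X ^ 2 + X + 1) := by simp [critOrbit]; ring
  have zX : toRat X ≠ 0 := toRat_ne_zero X_ne_zero
  have f2 : critOrbit (r + 2) + critOrbit r = (critOrbit (r + 1) + critOrbit r) *
      (critOrbit (r + 1) - critOrbit r + 1) := by
    rw [critOrbit_succ (r + 1), critOrbit_succ r]; ring
  have f3 : critOrbit (r + 3) + critOrbit r = (critOrbit (r + 1) + critOrbit r) *
      ((critOrbit (r + 2) - critOrbit r) * (critOrbit (r + 1) - critOrbit r + 1) + 1) := by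
    rw [critOrbit_succ (r + 2), critOrbit_succ (r + 1), critOrbit_succ r]; ring
  have mu2 : ArithmeticFunction.moebius 2 = -1 :=
    ArithmeticFunction.moebius_apply_prime Nat.prime_two
  have mu3 : ArithmeticFunction.moebius 3 = -1 :=
    ArithmeticFunction.moebius_apply_prime Nat.prime_three
  have d2 : Nat.divisors 2 = {1, 2} := by decide
  have d3 : Nat.divisors 3 = {1, 3} := by decide
  obtain rfl | rfl | rfl : n = 1 ∨ n = 2 ∨ n = 3 := by omega
  · obtain ⟨P, hP⟩ := dvd_add (X_dvd_critOrbit (r + 1)) (X_dvd_critOrbit r)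
    refine ⟨P, monic_X.of_mul_monic_left (hP ▸ m1), ?_⟩
    simp [misiurewiczProd, c1, hP, toRat_mul]
    field_simp
  · rw [f2] at m2
    have mQ := m1.of_mul_monic_left m2
    by_cases hd : 2 ∣ r
    · obtain ⟨j, rfl⟩ := hd
      have h0 := critOrbit_dvd_sub 2 0 j
      have h1 := critOrbit_dvd_sub 2 1 j
      have hX : (X + 1 : ℤ[X]) ∣ critOrbit 2 := ⟨X, by rw [c2]; ring⟩
      obtain ⟨P, hP⟩ : (X + 1 : ℤ[X]) ∣ critOrbit (2 * j + 1) - critOrbit (2 * j) + 1 := by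
        have := dvd_add (dvd_sub (hX.trans h1) (hX.trans h0)) dvd_rfl
        convert this using 1
        rw [c1]; simp [critOrbit]; ring
      have mg : (X + 1 : ℤ[X]).Monic := by monicity!
      have zg := toRat_ne_zero mg.ne_zero
      refine ⟨P, mg.of_mul_monic_left (hP ▸ mQ), ?_⟩
      simp [misiurewiczProd, d2, mu2, e, f2, c1, c2, hP, toRat_mul]
      field_simp
    · refine ⟨_, mQ, ?_⟩
      simp [misiurewiczProd, d2, mu2, e, f2, hd, toRat_mul]
      field_simp
  · rw [f3] at m3
    have mQ := m1.of_mul_monic_left m3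
    by_cases hd : 3 ∣ r
    · obtain ⟨j, rfl⟩ := hd
      have h0 := critOrbit_dvd_sub 3 0 j
      have h1 := critOrbit_dvd_sub 3 1 j
      have h2 := critOrbit_dvd_sub 3 2 j
      have hX : (X ^ 3 + 2 * X ^ 2 + X + 1 : ℤ[X]) ∣ critOrbit 3 := ⟨X, by rw [c3]; ring⟩
      obtain ⟨u, hu⟩ := hX.trans h0
      obtain ⟨v, hv⟩ := hX.trans h1
      obtain ⟨w, hw⟩ := hX.trans h2
      obtain ⟨P, hP⟩ : (X ^ 3 + 2 * X ^ 2 + X + 1 : ℤ[X]) ∣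
          (critOrbit (3 * j + 2) - critOrbit (3 * j)) *
            (critOrbit (3 * j + 1) - critOrbit (3 * j) + 1) + 1 := by
        rw [sub_eq_iff_eq_add] at hu hv hw
        rw [c1] at hv
        rw [c2] at hw
        rw [hw, hv, show critOrbit (3 * j) = (X ^ 3 + 2 * X ^ 2 + X + 1) * u by
          simpa [critOrbit] using hu]
        refine ⟨(w - u) * ((X ^ 3 + 2 * X ^ 2 + X + 1) * (v - u) + X + 1) +
          X * (X + 1) * (v - u) + 1, ?_⟩
        ring
      have mg : (X ^ 3 + 2 * X ^ 2 + X + 1 : ℤ[X]).Monic := by monicity!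
      have zg := toRat_ne_zero mg.ne_zero
      refine ⟨P, mg.of_mul_monic_left (hP ▸ mQ), ?_⟩
      simp [misiurewiczProd, d3, mu3, e, f3, c1, c3, hP, toRat_mul]
      field_simp
    · refine ⟨_, mQ, ?_⟩
      simp [misiurewiczProd, d3, mu3, e, f3, hd, toRat_mul]
      field_simp

/-! Write `m = r + 1`. For `l = n` the value is `0`. For `l = 2`, `n = 3`, a multiple of `G_{m,3}`
equals `(a_{r+2} - a_r)(a_{r+1} - a_r + 1) + 1`, and `G_{m,2}` divides `a_{r+1} - a_r + 1`, so its
value at a root of `G_{m,3}` divides `-1`.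

For `l = 1`, `n = 2, 3`, the polynomial `G_{m,n}` is irreducible by Eisenstein at `2`
(`irreducible_misiurewicz_two`, `irreducible_misiurewicz_three`). Hence one common zero of `G_{m,n}`
and `G_{m,1}` in any field rules out a unit at every root (`false_of_isIntegral_inv`). The common
zero is a parameter for which the critical orbit lands on a fixed point `w / 2` whose multiplier `w`
is a primitive `n`-th root of unity: `a_r = -w / 2`, and all later terms are `w / 2`. Such a
parameter exists in a residue field of `ℤ[w]` as soon as the denominator-free form of `a_r + w / 2`
is not a unit (`exists_hom_of_not_isUnit`). This is proved by a size estimate for `w = -1` and by a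
`2`-adic one for `w = ω`. -/

/-! ### Denominator-free identities for the Misiurewicz polynomials -/

theorem toRat_injective : Function.Injective toRat := fun _ _ h =>
  Polynomial.map_injective (Int.castRingHom ℚ) (RingHom.injective_int _)
    (FaithfulSMul.algebraMap_injective ℚ[X] (RatFunc ℚ) h)

theorem critOrbit_one : critOrbit 1 = X := by simp [critOrbit]

theorem critOrbit_two : critOrbit 2 = X * (X + 1) := by simp [critOrbit]; ring

theorem critOrbit_three : critOrbit 3 = X * (X ^ 3 + 2 * X ^ 2 + X + 1) := by
  simp [critOrbit]; ring

theorem critOrbit_add_two_add (r : ℕ) : critOrbit (r + 2) + critOrbit r =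
    (critOrbit (r + 1) + critOrbit r) * (critOrbit (r + 1) - critOrbit r + 1) := by
  rw [critOrbit_succ (r + 1), critOrbit_succ r]; ring

theorem critOrbit_add_three_add (r : ℕ) : critOrbit (r + 3) + critOrbit r =
    (critOrbit (r + 1) + critOrbit r) *
      ((critOrbit (r + 2) - critOrbit r) * (critOrbit (r + 1) - critOrbit r + 1) + 1) := by
  rw [critOrbit_succ (r + 2), critOrbit_succ (r + 1), critOrbit_succ r]; ring

theorem misiurewicz_one_spec (r : ℕ) (hr : 1 ≤ r) :
    ∃ P : ℤ[X], P.Monic ∧ misiurewicz (r + 1) 1 = P.map (Int.castRingHom ℚ) ∧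
      X * P = critOrbit (r + 1) + critOrbit r := by
  obtain ⟨P, h1, h2, h3⟩ := misiurewicz_eq_map (r + 1) 1 (by omega) le_rfl (by norm_num)
  refine ⟨P, h1, h3, toRat_injective ?_⟩
  have zX : toRat X ≠ 0 := toRat_ne_zero X_ne_zero
  simp [misiurewiczProd, critOrbit_one] at h2
  rw [toRat_mul, ← h2]
  field_simp

/-- The factor `a_{r+1} + a_r` cancels from the Möbius quotient, and the correction present when `n
∣ r` amounts to division by `a_n / a_1`. The case `n = 3` has the same shape. -/
theorem misiurewicz_two_spec (r : ℕ) (hr : 1 ≤ r) :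
    ∃ P : ℤ[X], P.Monic ∧ misiurewicz (r + 1) 2 = P.map (Int.castRingHom ℚ) ∧
      (if 2 ∣ r then X + 1 else 1) * P = critOrbit (r + 1) - critOrbit r + 1 := by
  obtain ⟨P, h1, h2, h3⟩ := misiurewicz_eq_map (r + 1) 2 (by omega) (by norm_num) (by norm_num)
  refine ⟨P, h1, h3, toRat_injective ?_⟩
  have zX : toRat X ≠ 0 := toRat_ne_zero X_ne_zero
  have z1 := toRat_ne_zero (critOrbit_add_monic r 1 hr le_rfl).ne_zero
  have zg : toRat (X + 1) ≠ 0 := toRat_ne_zero (X_add_C_ne_zero 1)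
  have mu2 : ArithmeticFunction.moebius 2 = -1 :=
    ArithmeticFunction.moebius_apply_prime Nat.prime_two
  have d2 : Nat.divisors 2 = {1, 2} := by decide
  simp only [misiurewiczProd, d2, add_tsub_cancel_right] at h2
  by_cases hd : 2 ∣ r
  · simp [mu2, critOrbit_add_two_add, hd, toRat_mul, critOrbit_one, critOrbit_two] at h2
    rw [if_pos hd, toRat_mul, ← h2]
    field_simp
  · simp [mu2, critOrbit_add_two_add, hd, toRat_mul] at h2
    rw [if_neg hd, one_mul, ← h2]
    field_simp

theorem misiurewicz_three_spec (r : ℕ) (hr : 1 ≤ r) :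
    ∃ P : ℤ[X], P.Monic ∧ misiurewicz (r + 1) 3 = P.map (Int.castRingHom ℚ) ∧
      (if 3 ∣ r then X ^ 3 + 2 * X ^ 2 + X + 1 else 1) * P =
        (critOrbit (r + 2) - critOrbit r) * (critOrbit (r + 1) - critOrbit r + 1) + 1 := by
  obtain ⟨P, h1, h2, h3⟩ := misiurewicz_eq_map (r + 1) 3 (by omega) (by norm_num) (by norm_num)
  refine ⟨P, h1, h3, toRat_injective ?_⟩
  have zX : toRat X ≠ 0 := toRat_ne_zero X_ne_zero
  have z1 := toRat_ne_zero (critOrbit_add_monic r 1 hr le_rfl).ne_zero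
  have mg : (X ^ 3 + 2 * X ^ 2 + X + 1 : ℤ[X]).Monic := by monicity!
  have zg := toRat_ne_zero mg.ne_zero
  have mu3 : ArithmeticFunction.moebius 3 = -1 :=
    ArithmeticFunction.moebius_apply_prime Nat.prime_three
  have d3 : Nat.divisors 3 = {1, 3} := by decide
  simp only [misiurewiczProd, d3, add_tsub_cancel_right] at h2
  by_cases hd : 3 ∣ r
  · simp [mu3, critOrbit_add_three_add, hd, toRat_mul, critOrbit_one, critOrbit_three] at h2
    rw [if_pos hd, toRat_mul, ← h2]
    field_simp
  · simp [mu3, critOrbit_add_three_add, hd, toRat_mul] at h2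
    rw [if_neg hd, one_mul, ← h2]
    field_simp

/-! ### Irreducibility by Eisenstein at `2` -/

/-- A generalized Eisenstein criterion at the prime `2`. -/
theorem irreducible_of_map_two_eq_pow {q f s R : ℤ[X]} {k : ℕ} (hk : k ≠ 0) (hq : q.Monic)
    (hq_irr : Irreducible (q.map (algebraMap ℤ (ZMod 2)))) (hf : f.Monic)
    (hmap : f.map (algebraMap ℤ (ZMod 2)) = q.map (algebraMap ℤ (ZMod 2)) ^ k)
    (hfs : f = R + q * s) (hR : R.degree < q.degree) (i : ℕ) (hi : ¬ (4 : ℤ) ∣ R.coeff i) :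
    Irreducible f := by
  have hker : RingHom.ker (algebraMap ℤ (ZMod 2)) = Ideal.span {(2 : ℤ)} :=
    ZMod.ker_intCastRingHom 2
  refine generalizedEisenstein (K := ZMod 2) (p := k) hq_irr hq hf.isPrimitive ?_ (by simp [hf])
    (by rw [hmap, hf]; simp) fun h => hi ?_
  · have h := congrArg natDegree hmap
    rw [hf.natDegree_map, (hq.map _).natDegree_pow] at h
    rw [h]
    exact Nat.mul_pos (Nat.pos_of_ne_zero hk) hq_irr.natDegree_pos
  · have hmod : f %ₘ q = R := ((div_modByMonic_unique s R hq ⟨hfs.symm, hR⟩)).2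
    rw [hmod] at h
    have := congrArg (fun p => p.coeff i) h
    simp only [coeff_map, coeff_zero, Ideal.Quotient.eq_zero_iff_mem, hker,
      Ideal.span_singleton_pow, Ideal.mem_span_singleton] at this
    exact_mod_cast this

/-- Modulo `a_p ^ 2` the critical orbit from `a_1` on has period `p`. -/
theorem critOrbit_sq_dvd_sub (p j i : ℕ) :
    critOrbit p ^ 2 ∣ critOrbit (p * j + (i + 1)) - critOrbit (i + 1) := by
  have key : ∀ i, critOrbit p ^ 2 ∣ critOrbit (p + (i + 1)) - critOrbit (i + 1) := by
    intro i
    induction i with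
    | zero => simp [critOrbit]
    | succ i ih =>
      rw [← add_assoc, critOrbit_succ, critOrbit_succ (i + 1)]
      have : critOrbit (p + (i + 1)) ^ 2 + X - (critOrbit (i + 1) ^ 2 + X) =
        (critOrbit (p + (i + 1)) - critOrbit (i + 1)) *
          (critOrbit (p + (i + 1)) + critOrbit (i + 1)) := by ring
      exact this ▸ ih.mul_right _
  induction j with
  | zero => simp
  | succ j ih =>
    have h := dvd_add (key (p * j + i)) ih
    rw [show p + (p * j + i + 1) = p * (j + 1) + (i + 1) by ring,
      show p * j + i + 1 = p * j + (i + 1) by ring] at h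
    simpa using h

theorem critOrbit_map_two_succ_sub (i : ℕ) :
    (critOrbit (i + 1)).map (algebraMap ℤ (ZMod 2)) =
      (critOrbit i).map (algebraMap ℤ (ZMod 2)) + X ^ 2 ^ i := by
  induction i with
  | zero => simp [critOrbit]
  | succ i ih =>
    have h := ih
    rw [critOrbit_succ i] at h
    simp only [Polynomial.map_add, Polynomial.map_pow, map_X] at h
    rw [critOrbit_succ (i + 1), Polynomial.map_add, Polynomial.map_pow, ih, add_pow_char, map_X]
    linear_combination h

/-- Modulo `2`, consecutive orbit terms differ by `X ^ 2 ^ i`, so the right side becomes a power of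
`X + 1`; periodicity modulo `X + 1` gives remainder `2`. If `2 ∣ r`, one factor `X + 1` is divided
out, so periodicity is needed modulo `(X + 1) ^ 2`. -/
theorem irreducible_misiurewicz_two {r : ℕ} (hr : 1 ≤ r) {P : ℤ[X]} (hP : P.Monic)
    (h : (if 2 ∣ r then X + 1 else 1) * P = critOrbit (r + 1) - critOrbit r + 1) :
    Irreducible P := by
  have hq : (X + 1 : ℤ[X]).Monic := monic_X_add_C 1
  have hqm : (X + 1 : ℤ[X]).map (algebraMap ℤ (ZMod 2)) = X + 1 := by simp
  have hirr : Irreducible ((X + 1 : ℤ[X]).map (algebraMap ℤ (ZMod 2))) := by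
    rw [hqm]
    exact (monic_X_add_C (1 : ZMod 2)).irreducible_of_degree_eq_one (degree_X_add_C 1)
  have hR : (C 2 : ℤ[X]).degree < (X + 1 : ℤ[X]).degree :=
    degree_C_le.trans_lt (by rw [← C_1, degree_X_add_C]; norm_num)
  have hmap : (critOrbit (r + 1) - critOrbit r + 1).map (algebraMap ℤ (ZMod 2)) =
      (X + 1) ^ 2 ^ r := by
    simp only [Polynomial.map_add, Polynomial.map_sub, critOrbit_map_two_succ_sub,
      Polynomial.map_one, add_pow_char_pow]
    ring
  have hpow : 2 ≤ 2 ^ r := Nat.le_self_pow (by omega) 2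
  by_cases hd : 2 ∣ r
  · rw [if_pos hd] at h
    obtain ⟨j, rfl⟩ := hd
    obtain ⟨j, rfl⟩ : ∃ i, j = i + 1 := ⟨j - 1, by omega⟩
    obtain ⟨u, hu⟩ := critOrbit_sq_dvd_sub 2 j 1
    obtain ⟨v, hv⟩ := critOrbit_sq_dvd_sub 2 (j + 1) 0
    rw [show 2 * j + (1 + 1) = 2 * (j + 1) by ring, sub_eq_iff_eq_add, critOrbit_two] at hu
    rw [zero_add, sub_eq_iff_eq_add, critOrbit_two, critOrbit_one] at hv
    have hP' : P = C 2 + (X + 1) * (-1 + X ^ 2 * (v - u)) := by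
      apply mul_left_cancel₀ hq.ne_zero
      rw [h, hu, hv, show (C 2 : ℤ[X]) = 2 from rfl]
      ring
    refine irreducible_of_map_two_eq_pow (k := 2 ^ (2 * (j + 1)) - 1) (by omega) hq hirr hP ?_
      hP' hR 0 (by norm_num)
    have := congrArg (Polynomial.map (algebraMap ℤ (ZMod 2))) h
    rw [hmap, Polynomial.map_mul, hqm] at this
    apply mul_left_cancel₀ (hqm ▸ hirr.ne_zero)
    rw [this, hqm, mul_pow_sub_one (by omega)]
  · rw [if_neg hd, one_mul] at h
    obtain ⟨j, rfl⟩ : ∃ j, r = 2 * j + 1 := ⟨r / 2, by omega⟩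
    have hX : (X + 1 : ℤ[X]) ∣ critOrbit 2 := ⟨X, by rw [critOrbit_two]; ring⟩
    obtain ⟨u, hu⟩ := hX.trans (critOrbit_dvd_sub 2 1 j)
    obtain ⟨v, hv⟩ := hX.trans (critOrbit_dvd_sub 2 2 j)
    rw [sub_eq_iff_eq_add, critOrbit_one] at hu
    rw [sub_eq_iff_eq_add, critOrbit_two] at hv
    refine irreducible_of_map_two_eq_pow (k := 2 ^ (2 * j + 1)) (by omega) hq hirr hP
      (by rw [h, hmap, hqm]) (s := v - u + X - 1) ?_ hR 0 (by norm_num)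
    rw [h, show 2 * j + 1 + 1 = 2 * j + 2 by ring, hu, hv, show (C 2 : ℤ[X]) = 2 from rfl]
    ring

/-- With `Y = X ^ 2 ^ r`, the right side is `Y ^ 3 + Y + 1` modulo `2`, a Frobenius power of the
irreducible cubic `X ^ 3 + X + 1`. The remainder is found from period `3` modulo the lift `a_3 / X`.
-/
theorem irreducible_misiurewicz_three {r : ℕ} (hr : 1 ≤ r) {P : ℤ[X]} (hP : P.Monic)
    (h : (if 3 ∣ r then X ^ 3 + 2 * X ^ 2 + X + 1 else 1) * P =
      (critOrbit (r + 2) - critOrbit r) * (critOrbit (r + 1) - critOrbit r + 1) + 1) :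
    Irreducible P := by
  set q : ℤ[X] := X ^ 3 + 2 * X ^ 2 + X + 1 with hqdef
  have hq : q.Monic := by rw [hqdef]; monicity!
  have hdeg : q.degree = 3 := by rw [hqdef]; compute_degree!
  have h2 : (2 : (ZMod 2)[X]) = 0 := CharTwo.two_eq_zero
  have hqm : q.map (algebraMap ℤ (ZMod 2)) = X ^ 3 + X + 1 := by
    simp [hqdef, h2]
  have hirr : Irreducible (q.map (algebraMap ℤ (ZMod 2))) := by
    have hnd : (q.map (algebraMap ℤ (ZMod 2))).natDegree = 3 := by
      rw [hq.natDegree_map, natDegree_eq_of_degree_eq_some hdeg]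
    rw [(hq.map _).irreducible_iff_roots_eq_zero_of_degree_le_three (by omega) (by omega)]
    refine Multiset.eq_zero_of_forall_notMem fun a ha => ?_
    have := isRoot_of_mem_roots ha
    rw [hqm] at this
    simp only [IsRoot, eval_add, eval_pow, eval_X, eval_one] at this
    clear ha
    revert a
    decide
  have hmap : ((critOrbit (r + 2) - critOrbit r) * (critOrbit (r + 1) - critOrbit r + 1) + 1).map
      (algebraMap ℤ (ZMod 2)) = q.map (algebraMap ℤ (ZMod 2)) ^ 2 ^ r := by
    simp only [Polynomial.map_add, Polynomial.map_sub, Polynomial.map_mul,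
      critOrbit_map_two_succ_sub, Polynomial.map_one, hqm, add_pow_char_pow, one_pow]
    linear_combination (X ^ 2 ^ r) ^ 2 * h2
  have hpow : 2 ≤ 2 ^ r := Nat.le_self_pow (by omega) 2
  have hR : (C 2 : ℤ[X]).degree < q.degree := degree_C_le.trans_lt (by rw [hdeg]; norm_num)
  have hX : q ∣ critOrbit 3 := ⟨X, by rw [critOrbit_three]; ring⟩
  by_cases hd : 3 ∣ r
  · rw [if_pos hd] at h
    obtain ⟨j, rfl⟩ := hd
    obtain ⟨j, rfl⟩ : ∃ i, j = i + 1 := ⟨j - 1, by omega⟩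
    obtain ⟨u, hu⟩ := critOrbit_sq_dvd_sub 3 j 2
    obtain ⟨v, hv⟩ := critOrbit_sq_dvd_sub 3 (j + 1) 0
    obtain ⟨w, hw⟩ := critOrbit_sq_dvd_sub 3 (j + 1) 1
    rw [show 3 * j + (2 + 1) = 3 * (j + 1) by ring, sub_eq_iff_eq_add, critOrbit_three,
      ← hqdef] at hu
    rw [zero_add, sub_eq_iff_eq_add, critOrbit_three, critOrbit_one, ← hqdef] at hv
    rw [one_add_one_eq_two, sub_eq_iff_eq_add, critOrbit_three, critOrbit_two, ← hqdef] at hw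
    -- Modulo `q ^ 2` the three terms are `X * q`, `X`, `X ^ 2 + X`, and `(X ^ 2 + X - X * q) * (X +
    -- 1 - X * q) + 1 ≡ 2 * q`; dividing by `q` leaves `2` modulo `q`.
    have hP' : P = C 2 + q * (X ^ 2 - 1 + X ^ 2 * (w - u) * (X + 1 - X * q) +
        X ^ 2 * (v - u) * (X ^ 2 + X - X * q) + X ^ 4 * q ^ 2 * (w - u) * (v - u)) := by
      apply mul_left_cancel₀ hq.ne_zero
      rw [h, hu, hv, hw, show (C 2 : ℤ[X]) = 2 from rfl]
      linear_combination (q - 1) * hqdef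
    refine irreducible_of_map_two_eq_pow (k := 2 ^ (3 * (j + 1)) - 1) (by omega) hq hirr hP ?_
      hP' hR 0 (by norm_num)
    have := congrArg (Polynomial.map (algebraMap ℤ (ZMod 2))) h
    rw [hmap, Polynomial.map_mul] at this
    apply mul_left_cancel₀ hirr.ne_zero
    rw [this, mul_pow_sub_one (by omega)]
  · rw [if_neg hd, one_mul] at h
    obtain ⟨u, hu⟩ := hX.trans (critOrbit_dvd_sub 3 0 (r / 3 + 1))
    obtain ⟨v, hv⟩ := hX.trans (critOrbit_dvd_sub 3 1 (r / 3))
    obtain ⟨w, hw⟩ := hX.trans (critOrbit_dvd_sub 3 2 (r / 3))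
    obtain ⟨v', hv'⟩ := hX.trans (critOrbit_dvd_sub 3 1 (r / 3 + 1))
    rw [sub_eq_iff_eq_add, critOrbit_one] at hv hv'
    rw [sub_eq_iff_eq_add, critOrbit_two] at hw
    rw [sub_eq_iff_eq_add, show critOrbit 0 = 0 from rfl, add_zero, add_zero] at hu
    -- Modulo `q`, `(a_r, a_{r+1}, a_{r+2})` is `(X, X ^ 2 + X, 0)` or `(X ^ 2 + X, 0, X)`, with
    -- remainders `2 * X ^ 2 + 2` and `2`.
    obtain hr3 | hr3 : r % 3 = 1 ∨ r % 3 = 2 := by omega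
    · rw [show 3 * (r / 3) + 1 = r by omega] at hv
      rw [show 3 * (r / 3) + 2 = r + 1 by omega] at hw
      rw [show 3 * (r / 3 + 1) = r + 2 by omega] at hu
      refine irreducible_of_map_two_eq_pow (k := 2 ^ r) (by omega) hq hirr hP
        (by rw [h, hmap]) (R := C 2 * X ^ 2 + C 2)
        (s := (u - v) * (X ^ 2 + 1 + q * (w - v)) - X * (w - v) - 1) ?_ ?_ 0 (by simp)
      · rw [h, hu, hv, hw, show (C 2 : ℤ[X]) = 2 from rfl]
        linear_combination hqdef
      · rw [hdeg]
        compute_degree!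
    · rw [show 3 * (r / 3) + 2 = r by omega] at hw
      rw [show 3 * (r / 3 + 1) = r + 1 by omega] at hu
      rw [show 3 * (r / 3 + 1) + 1 = r + 2 by omega] at hv'
      refine irreducible_of_map_two_eq_pow (k := 2 ^ r) (by omega) hq hirr hP
        (by rw [h, hmap]) (R := C 2)
        (s := (v' - w) * (1 - X ^ 2 - X + q * (u - w)) - X ^ 2 * (u - w) + X - 1) ?_ hR 0
        (by simp)
      rw [h, hu, hv', hw, show (C 2 : ℤ[X]) = 2 from rfl]
      linear_combination (1 - X) * hqdef

/-! ### Common zeros obstruct units -/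

/-- If `P(z)` has an integral inverse, where `z` is a root of the irreducible monic polynomial
`G`, then `P` and `G` have no common zero in any field. -/
theorem false_of_isIntegral_inv {G P : ℤ[X]} (hG : G.Monic) (hirr : Irreducible G) {z v : ℂ}
    (hz : aeval z G = 0) (hv : IsIntegral ℤ v) (hPv : aeval z P * v = 1)
    {F : Type*} [Field F] (ψ : ℤ[X] →+* F) (hψG : ψ G = 0) (hψP : ψ P = 0) : False := by
  have hint : IsIntegral ℤ z := ⟨G, hG, hz⟩
  have hdvd : ∀ Q : ℤ[X], aeval z Q = 0 → G ∣ Q := by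
    intro Q hQ
    have h1 := minpoly.isIntegrallyClosed_dvd hint hz
    have h2 := (minpoly.prime_of_isIntegrallyClosed hint).irreducible.not_isUnit
    exact ((hirr.dvd_iff.mp h1).resolve_left h2).dvd.trans
      (minpoly.isIntegrallyClosed_dvd hint hQ)
  obtain ⟨f, hf, hfv⟩ := hv
  let : Invertible v := ⟨aeval z P, hPv, by rw [mul_comm]; exact hPv⟩
  -- The reversal of the monic `f` kills `1 / v` and has constant term `1`; this `1` is what
  -- survives under `ψ`.
  have h1 : aeval (aeval z P) f.reverse = 0 :=
    (eval₂_reverse_eq_zero_iff (algebraMap ℤ ℂ) v f).mpr hfv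
  obtain ⟨s, hs⟩ := hdvd (f.reverse.comp P) (by rw [aeval_comp, h1])
  have h2 := congrArg ψ hs
  rw [map_mul, hψG, zero_mul, comp, hom_eval₂, hψP, eval₂_at_zero, coeff_zero_reverse,
    hf.leadingCoeff] at h2
  simp at h2

/-! ### Landing on a fixed point of multiplier `w` -/

/-- The critical orbit of `z ↦ z ^ 2 + c` with `4 * c = 2 * w - w ^ 2`, its `i`-th term multiplied
by `2 ^ 2 ^ i`. The point `w / 2` is fixed, of multiplier `w`. -/
def scaledOrbit {R : Type*} [CommRing R] (w : R) : ℕ → R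
  | 0 => 0
  | i + 1 => scaledOrbit w i ^ 2 + 4 ^ (2 ^ i - 1) * (2 * w - w ^ 2)

theorem two_pow_two_pow_succ_sub_one (i : ℕ) : 2 ^ (i + 1) - 1 = 2 * (2 ^ i - 1) + 1 := by
  have := Nat.one_le_two_pow (n := i)
  rw [pow_succ]
  omega

theorem map_scaledOrbit {R S : Type*} [CommRing R] [CommRing S] (f : R →+* S) (w : R) (i : ℕ) :
    f (scaledOrbit w i) = scaledOrbit (f w) i := by
  induction i with
  | zero => simp [scaledOrbit]
  | succ i ih => simp [scaledOrbit, ih, map_ofNat]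

theorem scaledOrbit_eq {F : Type*} [Field F] {w c : F} (hc : 4 * c = 2 * w - w ^ 2) (i : ℕ) :
    scaledOrbit w i = 2 ^ 2 ^ i * eval₂ (Int.castRingHom F) c (critOrbit i) := by
  induction i with
  | zero => simp [scaledOrbit, critOrbit]
  | succ i ih =>
    obtain ⟨k, hk⟩ : ∃ k, 2 ^ i = k + 1 := ⟨2 ^ i - 1, by have := Nat.one_le_two_pow (n := i); omega⟩
    have h4 : (4 : F) ^ k = 2 ^ (2 * k) := by rw [pow_mul]; norm_num
    rw [scaledOrbit, critOrbit, ih, ← hc, eval₂_add, eval₂_pow, eval₂_X, pow_succ 2 i, hk, add_tsub_cancel_right, h4]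
    ring

/-- In characteristic `2` the orbit is `-w ^ 2` followed by iterated squares. This excludes residue
characteristic `2`, so the scaling can be undone. -/
theorem scaledOrbit_ne_zero_of_two_eq_zero {F : Type*} [Field F] {w : F} (hw : w ≠ 0)
    (h2 : (2 : F) = 0) (i : ℕ) : scaledOrbit w (i + 1) ≠ 0 := by
  have h4 : (4 : F) = 0 := by linear_combination 2 * h2
  induction i with
  | zero => simpa [scaledOrbit, h2] using hw
  | succ i ih =>
    have h : 2 ^ (i + 1) - 1 ≠ 0 := by rw [two_pow_two_pow_succ_sub_one]; omega
    rw [scaledOrbit, h4, zero_pow h, zero_mul, add_zero]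
    exact pow_ne_zero 2 ih

/-- Unless the number is a unit, the critical orbit reaches the fixed point `w / 2` after exactly
`r + 1` steps in some residue field. -/
theorem exists_hom_of_not_isUnit {R : Type} [CommRing R] {w : R} (hw : IsUnit w) {r : ℕ}
    (hr : 1 ≤ r) (h : ¬ IsUnit (scaledOrbit w r + 2 ^ (2 ^ r - 1) * w)) :
    ∃ (F : Type) (_ : Field F) (f : R →+* F) (ψ : ℤ[X] →+* F), (2 : F) ≠ 0 ∧
      2 * ψ (critOrbit r) = -f w ∧ ∀ i, 2 * ψ (critOrbit (r + 1 + i)) = f w := by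
  obtain ⟨M, hM, hTM⟩ := exists_max_ideal_of_mem_nonunits h
  let := Ideal.Quotient.field M
  set f := Ideal.Quotient.mk M with hf
  have hT := Ideal.Quotient.eq_zero_iff_mem.mpr hTM
  rw [map_add, map_mul, map_pow, map_ofNat, map_scaledOrbit] at hT
  have hfw : f w ≠ 0 := (hw.map f).ne_zero
  have h2 : (2 : R ⧸ M) ≠ 0 := by
    intro h2
    obtain ⟨i, rfl⟩ : ∃ i, r = i + 1 := ⟨r - 1, by omega⟩
    refine scaledOrbit_ne_zero_of_two_eq_zero hfw h2 i ?_
    rwa [h2, zero_pow (by rw [two_pow_two_pow_succ_sub_one]; omega), zero_mul, add_zero] at hT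
  have h4 : (4 : R ⧸ M) ≠ 0 := by
    rw [show (4 : R ⧸ M) = 2 ^ 2 by norm_num]
    exact pow_ne_zero 2 h2
  set c : R ⧸ M := (2 * f w - f w ^ 2) / 4 with hc
  have hc' : 4 * c = 2 * f w - f w ^ 2 := by rw [hc]; field_simp
  set ψ := eval₂RingHom (Int.castRingHom (R ⧸ M)) c with hψ
  have hstep : ∀ i, ψ (critOrbit (i + 1)) = ψ (critOrbit i) ^ 2 + c := by
    intro i
    rw [critOrbit_succ, map_add, map_pow]
    simp [hψ]
  have h0 : 2 * ψ (critOrbit r) = -f w := by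
    rw [scaledOrbit_eq hc', ← mul_pow_sub_one (Nat.pos_iff_ne_zero.mp (Nat.two_pow_pos r)) 2] at hT
    refine mul_left_cancel₀ (pow_ne_zero (2 ^ r - 1) h2) ?_
    simp only [hψ, coe_eval₂RingHom]
    linear_combination hT
  refine ⟨R ⧸ M, inferInstance, f, ψ, h2, h0, fun i => mul_left_cancel₀ h2 ?_⟩
  induction i with
  | zero =>
    rw [add_zero, hstep]
    linear_combination hc' + (2 * ψ (critOrbit r) - f w) * h0
  | succ i ih =>
    rw [← add_assoc, hstep]
    linear_combination hc' + (2 * ψ (critOrbit (r + 1 + i)) + f w) * mul_left_cancel₀ h2 ih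

/-! ### The landing number is not a unit for `w = -1` and `w = ω` -/

/-- The bound `key` makes each scaled term after the zeroth negative, so subtracting a positive
power of `2` gives an integer at most `-2`. -/
theorem not_isUnit_scaledOrbit_neg_one {r : ℕ} (hr : 1 ≤ r) :
    ¬ IsUnit (scaledOrbit (-1 : ℤ) r + 2 ^ (2 ^ r - 1) * (-1)) := by
  have key : ∀ i, scaledOrbit (-1 : ℤ) i ^ 2 < 3 * 4 ^ (2 ^ i - 1) := by
    intro i
    induction i with
    | zero => simp [scaledOrbit]
    | succ i ih =>
      have hK : (0 : ℤ) < 4 ^ (2 ^ i - 1) := by positivity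
      rw [two_pow_two_pow_succ_sub_one, scaledOrbit, pow_succ (4 : ℤ), pow_mul' (4 : ℤ)]
      nlinarith [sq_nonneg (scaledOrbit (-1 : ℤ) i)]
  obtain ⟨i, rfl⟩ : ∃ i, r = i + 1 := ⟨r - 1, by omega⟩
  have h1 : (1 : ℤ) ≤ 2 ^ (2 ^ (i + 1) - 1) := one_le_pow₀ (by norm_num)
  have h2 := key i
  rw [scaledOrbit, Int.isUnit_iff]
  omega

open QuadraticAlgebra in
-- Four times the norm of `x + y * ω` is `(2 * x - y) ^ 2 + 3 * y ^ 2`. With `y = 4 * z.im` a unit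
-- forces `z.im = 0`, and then `(1 + 4 * z.re) ^ 2 = 1`.
theorem eq_zero_of_isUnit_one_add_four_mul {z : QuadraticAlgebra ℤ (-1) (-1)}
    (h : IsUnit (1 + 4 * z)) : z = 0 := by
  have h4 : (4 : QuadraticAlgebra ℤ (-1) (-1)) * z = (4 : ℤ) • z := by simp [zsmul_eq_mul]
  rw [isUnit_iff_norm_isUnit, Int.isUnit_iff, norm_def, h4] at h
  simp only [re_add, im_add, re_one, im_one, re_smul, im_smul, smul_eq_mul] at h
  have him : z.im = 0 := by
    by_contra h0
    have : 1 ≤ z.im ^ 2 := Int.one_le_abs h0 |> fun h => by nlinarith [sq_abs z.im]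
    rcases h with h | h <;> nlinarith [sq_nonneg (2 * (1 + 4 * z.re) - 4 * z.im)]
  have hre : z.re = 0 := by
    rw [him] at h
    rcases h with h | h
    · have : z.re * (2 + 4 * z.re) = 0 := by linarith
      rcases mul_eq_zero.mp this with h | h <;> omega
    · nlinarith [sq_nonneg (1 + 4 * z.re)]
  ext <;> simp [him, hre]

open QuadraticAlgebra in
theorem not_isUnit_scaledOrbit_omega {r : ℕ} (hr : 1 ≤ r) :
    ¬ IsUnit (scaledOrbit (ω : QuadraticAlgebra ℤ (-1) (-1)) r + 2 ^ (2 ^ r - 1) * ω) := by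
  set w : QuadraticAlgebra ℤ (-1) (-1) := ω with hw
  have hw2 : w ^ 2 = -1 - w := by
    rw [hw, sq]
    ext <;> simp
  have hw3 : w ^ 3 = 1 := by linear_combination (w - 1) * hw2
  have hpow : ∀ k, w ^ k * w ^ (2 * k) = 1 := fun k => by
    rw [← pow_add, show k + 2 * k = 3 * k by ring, pow_mul, hw3, one_pow]
  have hcancel : ∀ {k y}, 2 ∣ w ^ k * y → 2 ∣ y := by
    intro k y h
    have := h.mul_left (w ^ (2 * k))
    rwa [← mul_assoc, mul_comm (w ^ (2 * k)), hpow, one_mul] at this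
  obtain rfl | hr2 : r = 1 ∨ 2 ≤ r := by omega
  -- The norm of `1 + 5 * ω` is `21`.
  · have : scaledOrbit w 1 + 2 ^ (2 ^ 1 - 1) * w = ⟨1, 5⟩ := by
      simp only [scaledOrbit]
      rw [hw2]
      norm_num
      rw [hw]
      ext <;> norm_num [omega]
    rw [this, isUnit_iff_norm_isUnit, norm_def, Int.isUnit_iff]
    norm_num
  -- The power of `2` is exact: squaring `w ^ N + 2 ^ k * y` gives the cross term `2 ^ (k + 1) * w ^
  -- N * y`, and all other corrections are divisible by `2 ^ (k + 2)`.
  have key : ∀ i, ∃ y, scaledOrbit w (i + 2) = w ^ 2 ^ (i + 2) + 2 ^ (i + 2) * y ∧ ¬ 2 ∣ y := by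
    intro i
    induction i with
    | zero =>
      refine ⟨2 * w - 1, ?_, fun h => ?_⟩
      · simp only [scaledOrbit]
        norm_num
        linear_combination (4 - 4 * w) * hw2
      · obtain ⟨t, ht⟩ := h
        have := congrArg re ht
        simp [hw, re_mul] at this
        omega
    | succ i ih =>
      obtain ⟨y, hy, hy2⟩ := ih
      obtain ⟨d, hd⟩ : ∃ d, 2 ^ (i + 2) - 1 = i + 2 + d := by
        have := Nat.lt_two_pow_self (n := i + 2)
        exact ⟨2 ^ (i + 2) - 1 - (i + 2), by omega⟩
      have h4 : (4 : QuadraticAlgebra ℤ (-1) (-1)) ^ (i + 2 + d) = 2 ^ (2 * (i + 2 + d)) := by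
        rw [pow_mul]
        norm_num
      refine ⟨w ^ 2 ^ (i + 2) * y + 2 * (2 ^ i * y ^ 2 + 2 ^ (i + 2 * d) * (2 * w - w ^ 2)), ?_,
        fun h => hy2 (hcancel ((dvd_add_left (dvd_mul_right _ _)).mp h))⟩
      rw [show i + 1 + 2 = i + 2 + 1 by ring, scaledOrbit, hy, hd, pow_succ 2 (i + 2), pow_mul, h4]
      ring
  obtain ⟨i, rfl⟩ : ∃ i, r = i + 2 := ⟨r - 2, by omega⟩
  obtain ⟨y, hy, hy2⟩ := key i
  -- The exponent exceeds `i + 2`, so the added multiple of `w` changes `y` only by a multiple of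
  -- `2`.
  obtain ⟨d, hd⟩ : ∃ d, 2 ^ (i + 2) - 1 = i + 3 + d := by
    have : i + 4 ≤ 2 ^ (i + 2) := by
      have := Nat.lt_two_pow_self (n := i)
      rw [pow_add]
      omega
    exact ⟨2 ^ (i + 2) - 1 - (i + 3), by omega⟩
  intro hT
  -- Multiplying by this power of `w` makes the number `1` modulo `4`.
  have hu : IsUnit (w ^ (2 * 2 ^ (i + 2))) :=
    IsUnit.of_mul_eq_one (w ^ 2 ^ (i + 2)) (by rw [mul_comm]; exact hpow _)
  have h1 := hT.mul hu
  rw [hy, hd, show (w ^ 2 ^ (i + 2) + 2 ^ (i + 2) * y + 2 ^ (i + 3 + d) * w) *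
      w ^ (2 * 2 ^ (i + 2)) =
      1 + 4 * (2 ^ i * (w ^ (2 * 2 ^ (i + 2)) * (y + 2 * (2 ^ d * w)))) by
    linear_combination hpow (2 ^ (i + 2))] at h1
  have h2 := eq_zero_of_isUnit_one_add_four_mul h1
  have h3 : ((2 ^ i : ℤ) : QuadraticAlgebra ℤ (-1) (-1)) *
      (w ^ (2 * 2 ^ (i + 2)) * (y + 2 * (2 ^ d * w))) = 0 := by
    push_cast
    exact h2
  rw [← zsmul_eq_mul] at h3
  have h4 : w ^ (2 * 2 ^ (i + 2)) * (y + 2 * (2 ^ d * w)) = 0 := by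
    have hne : (2 ^ i : ℤ) ≠ 0 := by positivity
    have hr := congrArg re h3
    have hi := congrArg im h3
    rw [re_smul, re_zero, smul_eq_mul, mul_eq_zero] at hr
    rw [im_smul, im_zero, smul_eq_mul, mul_eq_zero] at hi
    exact QuadraticAlgebra.ext (hr.resolve_left hne) (hi.resolve_left hne)
  exact hy2 ((dvd_add_left (dvd_mul_right _ _)).mp (hcancel (h4 ▸ dvd_zero 2)))

/-! ### Common zeros of `G_{m,n}` and `G_{m,1}` -/

theorem exists_hom_misiurewicz_two_one {r : ℕ} (hr : 1 ≤ r) {P Q : ℤ[X]}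
    (hP : (if 2 ∣ r then X + 1 else 1) * P = critOrbit (r + 1) - critOrbit r + 1)
    (hQ : X * Q = critOrbit (r + 1) + critOrbit r) :
    ∃ (F : Type) (_ : Field F) (ψ : ℤ[X] →+* F), ψ P = 0 ∧ ψ Q = 0 := by
  obtain ⟨F, _, f, ψ, h2, h0, hi⟩ := exists_hom_of_not_isUnit (w := (-1 : ℤ))
    isUnit_one.neg hr (not_isUnit_scaledOrbit_neg_one hr)
  rw [map_neg, map_one] at h0 hi
  -- Divisors of later orbit terms survive, since those terms equal `w / 2 ≠ 0`; this lets the extra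
  -- factors of `P` and `Q` be cancelled.
  have hne : ∀ g : ℤ[X], ∀ i, g ∣ critOrbit (r + 1 + i) → ψ g ≠ 0 := by
    intro g i hg h
    have h3 := hi i
    have h4 := map_dvd ψ hg
    rw [h, zero_dvd_iff] at h4
    rw [h4, mul_zero] at h3
    exact one_ne_zero (neg_eq_zero.mp h3.symm)
  have h1 := hi 0
  rw [add_zero] at h1
  refine ⟨F, inferInstance, ψ, ?_, ?_⟩
  · have h3 := congrArg ψ hP
    rw [map_mul, map_add ψ (_ - _), map_sub, map_one] at h3
    have h4 : ψ (if 2 ∣ r then X + 1 else 1) * ψ P = 0 := by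
      rw [h3]
      apply mul_left_cancel₀ h2
      linear_combination h1 - h0
    refine (mul_eq_zero.mp h4).resolve_left ?_
    split_ifs
    · refine hne _ (r + 1) ?_
      have h5 := critOrbit_dvd_sub 2 0 (r + 1)
      rw [show critOrbit 0 = 0 from rfl, sub_zero, add_zero, two_mul] at h5
      exact Dvd.dvd.trans ⟨X, by rw [critOrbit_two]; ring⟩ h5
    · simp
  · have h3 := congrArg ψ hQ
    rw [map_mul, map_add] at h3
    have h4 : ψ X * ψ Q = 0 := by
      rw [h3]
      apply mul_left_cancel₀ h2
      linear_combination h1 + h0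
    exact (mul_eq_zero.mp h4).resolve_left (hne _ 0 (X_dvd_critOrbit _))

open QuadraticAlgebra in
theorem exists_hom_misiurewicz_three_one {r : ℕ} (hr : 1 ≤ r) {P Q : ℤ[X]}
    (hP : (if 3 ∣ r then X ^ 3 + 2 * X ^ 2 + X + 1 else 1) * P =
      (critOrbit (r + 2) - critOrbit r) * (critOrbit (r + 1) - critOrbit r + 1) + 1)
    (hQ : X * Q = critOrbit (r + 1) + critOrbit r) :
    ∃ (F : Type) (_ : Field F) (ψ : ℤ[X] →+* F), ψ P = 0 ∧ ψ Q = 0 := by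
  have hω : (ω : QuadraticAlgebra ℤ (-1) (-1)) ^ 2 + ω + 1 = 0 := by
    rw [sq]
    ext <;> simp
  obtain ⟨F, _, f, ψ, h2, h0, hi⟩ := exists_hom_of_not_isUnit
    (w := (ω : QuadraticAlgebra ℤ (-1) (-1)))
    (IsUnit.of_mul_eq_one (-1 - ω) (by linear_combination -hω)) hr (not_isUnit_scaledOrbit_omega hr)
  have hw := congrArg f hω
  simp only [map_add, map_pow, map_one, map_zero] at hw
  have hw0 : f ω ≠ 0 := fun h => by simp [h] at hw
  have hne : ∀ g : ℤ[X], ∀ i, g ∣ critOrbit (r + 1 + i) → ψ g ≠ 0 := by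
    intro g i hg h
    have h3 := hi i
    have h4 := map_dvd ψ hg
    rw [h, zero_dvd_iff] at h4
    rw [h4, mul_zero] at h3
    exact hw0 h3.symm
  have h1 := hi 0
  have h1' := hi 1
  rw [add_zero] at h1
  rw [add_assoc, one_add_one_eq_two] at h1'
  refine ⟨F, inferInstance, ψ, ?_, ?_⟩
  · have h3 := congrArg ψ hP
    rw [map_mul, map_add ψ (_ * _), map_mul, map_add ψ (_ - _), map_sub, map_sub, map_one] at h3
    have h4 : ψ (if 3 ∣ r then X ^ 3 + 2 * X ^ 2 + X + 1 else 1) * ψ P = 0 := by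
      have e1 : ψ (critOrbit (r + 2)) - ψ (critOrbit r) = f ω := by
        apply mul_left_cancel₀ h2
        linear_combination h1' - h0
      have e2 : ψ (critOrbit (r + 1)) - ψ (critOrbit r) = f ω := by
        apply mul_left_cancel₀ h2
        linear_combination h1 - h0
      rw [h3, e1, e2]
      -- The product has become `ω * (ω + 1) + 1 = 0` under `f`.
      linear_combination hw
    refine (mul_eq_zero.mp h4).resolve_left ?_
    split_ifs
    · refine hne _ (2 * r + 2) ?_
      have h5 := critOrbit_dvd_sub 3 0 (r + 1)
      rw [show critOrbit 0 = 0 from rfl, sub_zero, add_zero,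
        show 3 * (r + 1) = r + 1 + (2 * r + 2) by ring] at h5
      exact Dvd.dvd.trans ⟨X, by rw [critOrbit_three]; ring⟩ h5
    · simp
  · have h3 := congrArg ψ hQ
    rw [map_mul, map_add] at h3
    have h4 : ψ X * ψ Q = 0 := by
      rw [h3]
      apply mul_left_cancel₀ h2
      linear_combination h1 + h0
    exact (mul_eq_zero.mp h4).resolve_left (hne _ 0 (X_dvd_critOrbit _))

/-! ### Assembly of the cases -/

theorem mainTheorem2 (m n l : ℕ) (hm : 2 ≤ m) (hn : n ≤ 3) (hl : 1 ≤ l) (hln : l ≤ n)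
    (c₀ : ℂ) (hc₀ : Polynomial.aeval c₀ (misiurewicz m n) = 0) :
    ∃ x : NumberField.RingOfIntegers (IntermediateField.adjoin ℚ {c₀}),
      ((x : IntermediateField.adjoin ℚ {c₀}) : ℂ) = Polynomial.aeval c₀ (misiurewicz m l) ∧
        (IsUnit x ↔ ¬ l ∣ n) := by
  obtain ⟨r, rfl⟩ : ∃ r, m = r + 1 := ⟨m - 1, by omega⟩
  have hr : 1 ≤ r := by omega
  have hcast : ∀ P : ℤ[X], aeval c₀ (P.map (Int.castRingHom ℚ)) = aeval c₀ P := fun P =>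
    aeval_map_algebraMap ℚ c₀ P
  obtain ⟨G, hG, -, hGeq⟩ := misiurewicz_eq_map (r + 1) n hm (by omega) hn
  have hGroot : aeval c₀ G = 0 := by rw [← hcast, ← hGeq, hc₀]
  set K := IntermediateField.adjoin ℚ {c₀}
  have hgen : IsIntegral ℤ (IntermediateField.AdjoinSimple.gen ℚ c₀) := by
    refine ⟨G, hG, ?_⟩
    apply (algebraMap K ℂ).injective
    rw [hom_eval₂, map_zero, ← hGroot, aeval_def]
    congr 1
  set g : NumberField.RingOfIntegers K := ⟨IntermediateField.AdjoinSimple.gen ℚ c₀, hgen⟩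
  set ι : NumberField.RingOfIntegers K →+* ℂ :=
    (algebraMap K ℂ).comp (algebraMap (NumberField.RingOfIntegers K) K) with hι
  have hιinj : Function.Injective ι :=
    (algebraMap K ℂ).injective.comp NumberField.RingOfIntegers.coe_injective
  have hιg : ∀ P : ℤ[X], ι (aeval g P) = aeval c₀ P := by
    intro P
    rw [aeval_def, hom_eval₂, aeval_def]
    congr 1
  have hnonunit : ∀ Q : ℤ[X], Irreducible G →
      (∃ (F : Type) (_ : Field F) (ψ : ℤ[X] →+* F), ψ G = 0 ∧ ψ Q = 0) →
      ¬ IsUnit (aeval g Q) := by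
    rintro Q hirr ⟨F, _, ψ, hψG, hψQ⟩ hu
    obtain ⟨y, hy⟩ := hu.exists_right_inv
    refine false_of_isIntegral_inv hG hirr hGroot (v := ι y) ?_ ?_ ψ hψG hψQ
    · exact y.2.map (IsScalarTower.toAlgHom ℤ K ℂ)
    · rw [← hιg, ← map_mul, hy, map_one]
  suffices h : ∃ Q : ℤ[X], misiurewicz (r + 1) l = Q.map (Int.castRingHom ℚ) ∧
      (IsUnit (aeval g Q) ↔ ¬ l ∣ n) by
    obtain ⟨Q, hQ, h⟩ := h
    exact ⟨aeval g Q, by rw [hQ, hcast]; exact hιg Q, h⟩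
  have hGinj : ∀ {P : ℤ[X]}, misiurewicz (r + 1) n = P.map (Int.castRingHom ℚ) → P = G :=
    fun h => map_injective _ (RingHom.injective_int _) (h ▸ hGeq)
  obtain rfl | hne := eq_or_ne l n
  · refine ⟨G, hGeq, ?_⟩
    have h0 : aeval g G = 0 := hιinj (by rw [hιg, hGroot, map_zero])
    simp [h0]
  obtain ⟨rfl, rfl⟩ | ⟨rfl, rfl⟩ | ⟨rfl, rfl⟩ :
      l = 1 ∧ n = 2 ∨ l = 1 ∧ n = 3 ∨ l = 2 ∧ n = 3 := by omega
  · obtain ⟨P, -, hP1, hP⟩ := misiurewicz_two_spec r hr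
    obtain ⟨Q, -, hQ1, hQ⟩ := misiurewicz_one_spec r hr
    obtain rfl := hGinj hP1
    exact ⟨Q, hQ1, iff_of_false (hnonunit Q (irreducible_misiurewicz_two hr hG hP)
      (exists_hom_misiurewicz_two_one hr hP hQ)) (by norm_num)⟩
  · obtain ⟨P, -, hP1, hP⟩ := misiurewicz_three_spec r hr
    obtain ⟨Q, -, hQ1, hQ⟩ := misiurewicz_one_spec r hr
    obtain rfl := hGinj hP1
    exact ⟨Q, hQ1, iff_of_false (hnonunit Q (irreducible_misiurewicz_three hr hG hP)
      (exists_hom_misiurewicz_three_one hr hP hQ)) (by norm_num)⟩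
  · obtain ⟨P, -, hP1, hP⟩ := misiurewicz_three_spec r hr
    obtain ⟨Q, -, hQ1, hQ⟩ := misiurewicz_two_spec r hr
    obtain rfl := hGinj hP1
    refine ⟨Q, hQ1, iff_of_true ?_ (by norm_num)⟩
    have h0 : aeval g P = 0 := hιinj (by rw [hιg, hGroot, map_zero])
    -- This exhibits `G_{m,2}` as a factor of the product that equals `-1` at the root.
    rw [← hQ] at hP
    have h1 := congrArg (aeval g) hP
    rw [map_mul, h0, mul_zero, map_add, map_mul, map_mul, map_one] at h1
    exact IsUnit.of_mul_eq_one (-(aeval g (critOrbit (r + 2) - critOrbit r) *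
      aeval g (if 2 ∣ r then X + 1 else 1))) (by linear_combination h1)
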